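/- All groups are finite. A formation is a class $\mathcal F$ of groups that is closed under homomorphic images and such that, if $\mathcal F\neq\varnothing$, then $G/G^{\mathcal F}\in\mathcal F$ for every group $G$, where $G^{\mathcal F}$ is the intersection of all normal subgroups $N$ of $G$ with $G/N\in\mathcal F$. It is saturated if $G\in\mathcal F$ whenever $G/\Phi(G)\in\mathcal F$ (where $\Phi(G)$ is the Frattini subgroup), and hereditary if $H\in\mathcal F$ whenever $H\le G\in\mathcal F$. A subgroup $U$ of $G$ is $\mathcal F$-maximal in $G$ if $U\in\mathcal F$ and $U=V$ whenever $U\le V\le G$ and $V\in\mathcal F$. A subgroup $H$ of $G$ is $K$-$\mathcal F$-subnormal in $G$ (in the sense of Kegel) if $H=G$ or there is a chain of subgroups $H=H_0<H_1<\dots<H_t=G$ such that, for each $i=1,\dots,t$, either $H_{i-1}$ is normal in $H_i$ or $H_i/(H_{i-1})_{H_i}\in\mathcal F$, where $(H_{i-1})_{H_i}$ is the largest normal subgroup of $H_i$ contained in $H_{i-1}$. **Theorem D.** Let $\mathcal F$ be a hereditary saturated formation containing all nilpotent groups. Then, for every group $G$, $$\mathrm{Int}^{*}_{\mathcal F}(G)=\mathrm{Int}_{\mathcal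 F}(G),$$ where $\mathrm{Int}_{\mathcal F}(G)$ is the intersection of all $\mathcal F$-maximal subgroups of $G$ and $\mathrm{Int}^{*}_{\mathcal F}(G)$ is the intersection of all $\mathcal F$-maximal subgroups of $G$ that are not $K$-$\mathcal F$-subnormal in $G$ (with $\mathrm{Int}^{*}_{\mathcal F}(G)=G$ if there are no such subgroups). -/

import Mathlib

universe u

/-- A class of finite groups (in a fixed universe). Closure under isomorphism is not built in: for a
formation it follows from closure under homomorphic images. -/
abbrev GroupClass : Type (u + 1) := ∀ (G : Type u) [Group G] [Finite G], Prop

namespace GroupClass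

/-- The residual `G^F`: the intersection of all normal subgroups `N` of `G` with `G ⧸ N` in `F`. -/
def residual (F : GroupClass.{u}) (G : Type u) [Group G] [Finite G] : Subgroup G :=
  sInf {N : Subgroup G | ∃ _ : N.Normal, F (G ⧸ N)}

instance residual_normal (F : GroupClass.{u}) (G : Type u) [Group G] [Finite G] :
    (residual F G).Normal where
  conj_mem := by
    intro n hn g
    simp only [residual, Subgroup.mem_sInf, Set.mem_ofPred_eq] at hn ⊢
    rintro N ⟨hN, hF⟩
    exact hN.conj_mem n (hn N ⟨hN, hF⟩) g

/-- A formation of finite groups. -/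
structure IsFormation (F : GroupClass.{u}) : Prop where
  /-- Every homomorphic image of a group in `F` is in `F`. -/
  image : ∀ (G H : Type u) [Group G] [Finite G] [Group H] [Finite H] (f : G →* H),
    Function.Surjective f → F G → F H
  /-- If `F` is non-empty, then `G ⧸ G^F` is in `F` for every finite group `G`. -/
  quotient_residual : (∃ (A : Type u) (_ : Group A) (_ : Finite A), F A) →
    ∀ (G : Type u) [Group G] [Finite G], F (G ⧸ residual F G)

/-- `F` is saturated: `G ∈ F` whenever `G ⧸ Φ(G) ∈ F`. -/
def IsSaturated (F : GroupClass.{u}) : Prop :=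
  ∀ (G : Type u) [Group G] [Finite G], F (G ⧸ frattini G) → F G

/-- `F` is hereditary: every subgroup of a group in `F` is in `F`. -/
def IsHereditary (F : GroupClass.{u}) : Prop :=
  ∀ (G : Type u) [Group G] [Finite G] (H : Subgroup G), F G → F H

/-- `F` contains all finite nilpotent groups. -/
def ContainsNilpotent (F : GroupClass.{u}) : Prop :=
  ∀ (G : Type u) [Group G] [Finite G], Group.IsNilpotent G → F G

variable {G : Type u} [Group G] [Finite G]

/-- `U` is an `F`-maximal subgroup of `G`: it is maximal among the subgroups of `G` in `F`. -/
def IsFMaximal (F : GroupClass.{u}) (U : Subgroup G) : Prop :=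
  Maximal (fun V : Subgroup G => F V) U

/-- One step `A < B` of a chain witnessing Kegel `F`-subnormality: `A` is normal in `B`, or the
quotient of `B` by the core `A_B` of `A` in `B` is in `F`. -/
def KStep (F : GroupClass.{u}) (A B : Subgroup G) : Prop :=
  A < B ∧ ((A.subgroupOf B).Normal ∨ F (B ⧸ (A.subgroupOf B).normalCore))

/-- `H` is `K`-`F`-subnormal in `G`: there is a chain `H = H₀ < H₁ < … < H_t = G`, `t ≥ 0`, of
subgroups all of whose steps are as in `KStep`. -/
def IsKSubnormal (F : GroupClass.{u}) (H : Subgroup G) : Prop :=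
  Relation.ReflTransGen (KStep F) H ⊤

variable (G)

/-- `Int_F(G)`: the intersection of all `F`-maximal subgroups of `G`. -/
def intMaximal (F : GroupClass.{u}) : Subgroup G :=
  sInf {U : Subgroup G | IsFMaximal F U}

/-- `Int*_F(G)`: the intersection of all `F`-maximal subgroups of `G` that are not
`K`-`F`-subnormal in `G` (the whole group `G` if there are none). -/
def intMaximalStar (F : GroupClass.{u}) : Subgroup G :=
  sInf {U : Subgroup G | IsFMaximal F U ∧ ¬ IsKSubnormal F U}

end GroupClass

/-!
Write `D = Int*_F(G)`. It is a normal subgroup, and `D ≤ U` has to be shown for each `F`-maximal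
subgroup `U`; by maximality it is enough that `U ⊔ D` is in `F`. As `(U ⊔ D) / D` is an image
of `U`, this follows from the claim that every `H ≤ G` with `H / (H ∩ D) ∈ F` is itself in `F`
(`mem_of_quotient_intMaximalStar`).

The claim is proved by induction on `H`. As `F` is a saturated formation, it suffices
that `H / M_H ∈ F` for each maximal subgroup `M` of `H` (`mem_of_forall_isCoatom`): the residual of `H`
is then contained in each `M`, hence in `Φ(H)`. If `H ∩ D ≤ M`, then `H / M_H` is an image of
`H / (H ∩ D)`. Otherwise `M ∈ F` by induction, so `M ≤ W` for some `F`-maximal subgroup `W` of `G`,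
and `W ∩ H = M` unless `H ≤ W` is in `F` already. Since `W` does not contain `D`, it is
`K`-`F`-subnormal in `G`. Intersecting a chain from `W` to `G` with `H`, the maximality of `M` forces
a single jump from `M` to `H`; hence `M` is normal in `H`, with `H / M` cyclic, or `H / M_H ∈ F`
(`mem_quotient_normalCore_of_isKSubnormal`).
-/

namespace GroupClass

variable {F : GroupClass.{u}}

/-- `H ⧸ N` is an image of `H ⧸ ker f`, which embeds in `B`. -/
theorem IsFormation.mem_quotient_of_ker_le (hform : F.IsFormation) (hher : F.IsHereditary)
    {H B : Type u} [Group H] [Finite H] [Group B] [Finite B] (f : H →* B) (hB : F B)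
    (N : Subgroup H) [N.Normal] (hN : f.ker ≤ N) : F (H ⧸ N) := by
  have h1 : F (H ⧸ f.ker) :=
    hform.image _ _ (QuotientGroup.quotientKerEquivRange f).symm.toMonoidHom
      (QuotientGroup.quotientKerEquivRange f).symm.surjective (hher B f.range hB)
  refine hform.image _ _ (QuotientGroup.map f.ker N (MonoidHom.id H) hN) ?_ h1
  intro x
  obtain ⟨y, rfl⟩ := QuotientGroup.mk_surjective x
  exact ⟨(y : H ⧸ f.ker), rfl⟩

theorem IsFormation.mem_quotient_normalCore (hform : F.IsFormation) (hher : F.IsHereditary)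
    {H B : Type u} [Group H] [Finite H] [Group B] [Finite B] (f : H →* B) (hB : F B)
    (A : Subgroup H) (hA : f.ker ≤ A) : F (H ⧸ A.normalCore) :=
  hform.mem_quotient_of_ker_le hher f hB _ (Subgroup.normal_le_normalCore.mpr hA)

theorem IsFormation.mem_of_mulEquiv (hform : F.IsFormation)
    {H B : Type u} [Group H] [Finite H] [Group B] [Finite B] (e : H ≃* B) (hH : F H) : F B :=
  hform.image H B e.toMonoidHom e.surjective hH

theorem IsHereditary.mem_of_le (hform : F.IsFormation) (hher : F.IsHereditary)
    {G : Type u} [Group G] [Finite G] {H K : Subgroup G} (hHK : H ≤ K) (hK : F K) : F H :=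
  hform.mem_of_mulEquiv (Subgroup.subgroupOfEquivOfLe hHK) (hher K (H.subgroupOf K) hK)

/-- A group all of whose quotients by cores of maximal subgroups lie in a saturated formation lies
in the formation. -/
theorem mem_of_forall_isCoatom (hform : F.IsFormation) (hsat : F.IsSaturated)
    (hher : F.IsHereditary) (hnil : F.ContainsNilpotent) {H : Type u} [Group H] [Finite H]
    (h : ∀ M : Subgroup H, IsCoatom M → F (H ⧸ M.normalCore)) : F H := by
  apply hsat
  have hres : F (H ⧸ residual F H) :=
    hform.quotient_residual ⟨PUnit, inferInstance, inferInstance, hnil _ inferInstance⟩ H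
  -- The residual lies in every maximal subgroup of `H`, hence in the Frattini subgroup.
  refine hform.mem_quotient_of_ker_le hher (QuotientGroup.mk' (residual F H)) hres _ ?_
  rw [QuotientGroup.ker_mk']
  refine le_iInf₂ fun M hM => ?_
  exact (sInf_le ⟨inferInstance, h M hM⟩ : residual F H ≤ M.normalCore).trans
    (Subgroup.normalCore_le M)

/-- The quotient by a normal maximal subgroup is cyclic, hence nilpotent. -/
theorem ContainsNilpotent.mem_quotient_of_isCoatom (hnil : F.ContainsNilpotent)
    {H : Type u} [Group H] [Finite H] (M : Subgroup H) [M.Normal] (hM : IsCoatom M) :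
    F (H ⧸ M) := by
  apply hnil
  have hex : ∃ x, x ∉ M := by
    by_contra! hc
    exact hM.1 (eq_top_iff.mpr fun x _ => hc x)
  obtain ⟨x, hx⟩ := hex
  have htop : (Subgroup.zpowers (x : H ⧸ M)).comap (QuotientGroup.mk' M) = ⊤ := by
    apply hM.2
    refine lt_of_le_of_ne ?_ fun he => hx ?_
    · exact QuotientGroup.le_comap_mk' M _
    · rw [he]
      exact Subgroup.mem_zpowers (x : H ⧸ M)
  have : IsCyclic (H ⧸ M) := by
    refine ⟨⟨(x : H ⧸ M), fun y => ?_⟩⟩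
    obtain ⟨z, rfl⟩ := QuotientGroup.mk_surjective y
    exact (htop ▸ Subgroup.mem_top z :
      z ∈ (Subgroup.zpowers (x : H ⧸ M)).comap (QuotientGroup.mk' M))
  let := IsCyclic.commGroup (α := H ⧸ M)
  exact CommGroup.isNilpotent

variable {G : Type u} [Group G] [Finite G]

theorem exists_isFMaximal_le (F : GroupClass.{u}) {V : Subgroup G} (hV : F V) :
    ∃ U : Subgroup G, V ≤ U ∧ IsFMaximal F U :=
  (Set.toFinite {U : Subgroup G | F U}).exists_le_maximal hV

/-- If `W ∩ H` is maximal in `H` then some step `A < B` of a chain from `W` to `G` satisfies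
`A ∩ H = W ∩ H` and `H ≤ B`. -/
theorem IsKSubnormal.exists_kStep {W H : Subgroup G} (hW : IsKSubnormal F W)
    (hM : IsCoatom (W.subgroupOf H)) :
    ∃ A B : Subgroup G, KStep F A B ∧ H ≤ B ∧ A.subgroupOf H = W.subgroupOf H := by
  induction hW using Relation.ReflTransGen.head_induction_on with
  | refl => exact absurd (Subgroup.subgroupOf_eq_top.mpr le_top) hM.1
  | @head A B hAB _ ih =>
    have hle : A.subgroupOf H ≤ B.subgroupOf H := Subgroup.comap_mono hAB.1.le
    rcases hle.eq_or_lt with he | hlt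
    · obtain ⟨A', B', h1, h2, h3⟩ := ih (he ▸ hM)
      exact ⟨A', B', h1, h2, h3.trans he.symm⟩
    · exact ⟨A, B, hAB, Subgroup.subgroupOf_eq_top.mp (hM.2 _ hlt), rfl⟩

/-- A maximal subgroup `M` of `H` that is the trace of a `K`-`F`-subnormal subgroup of `G` satisfies
`H / M_H ∈ F`: a single step of the chain restricts to `M < H`. -/
theorem mem_quotient_normalCore_of_isKSubnormal (hform : F.IsFormation) (hher : F.IsHereditary)
    (hnil : F.ContainsNilpotent) {W H : Subgroup G} (hW : IsKSubnormal F W)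
    {M : Subgroup H} (hWM : W.subgroupOf H = M) (hM : IsCoatom M) : F (H ⧸ M.normalCore) := by
  obtain ⟨A, B, ⟨_, hstep⟩, hHB, he⟩ := hW.exists_kStep (hWM ▸ hM)
  obtain rfl : A.subgroupOf H = M := he.trans hWM
  rcases hstep with hn | hF
  · have hn' : (A.subgroupOf H).Normal := hn.comap (Subgroup.inclusion hHB)
    have hq := hnil.mem_quotient_of_isCoatom (A.subgroupOf H) hM
    refine hform.mem_quotient_normalCore hher (QuotientGroup.mk' (A.subgroupOf H)) hq _ ?_
    rw [QuotientGroup.ker_mk']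
  · refine hform.mem_quotient_normalCore hher
      ((QuotientGroup.mk' (A.subgroupOf B).normalCore).comp (Subgroup.inclusion hHB)) hF _ ?_
    intro x hx
    have hx' : Subgroup.inclusion hHB x ∈ (A.subgroupOf B).normalCore :=
      (QuotientGroup.eq_one_iff _).mp hx
    exact (Subgroup.normalCore_le (A.subgroupOf B) hx' :)

theorem KStep.map (hform : F.IsFormation) (hher : F.IsHereditary) (e : G ≃* G)
    {A B : Subgroup G} (h : KStep F A B) :
    KStep F (A.map e.toMonoidHom) (B.map e.toMonoidHom) := by
  refine ⟨(Subgroup.map_lt_map_iff_of_injective e.injective).mpr h.1, ?_⟩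
  let φ : B ≃* B.map e.toMonoidHom := e.subgroupMap B
  have hA : (A.map e.toMonoidHom).subgroupOf (B.map e.toMonoidHom)
      = (A.subgroupOf B).comap φ.symm.toMonoidHom := by
    ext x
    obtain ⟨y, rfl⟩ := φ.surjective x
    have h1 : ((φ y : B.map e.toMonoidHom) : G) = e y := rfl
    have h2 : φ.symm.toMonoidHom (φ y) = y := φ.symm_apply_apply y
    rw [Subgroup.mem_subgroupOf, h1, Subgroup.mem_comap, h2, Subgroup.mem_subgroupOf]
    exact Subgroup.mem_map_iff_mem e.injective
  rcases h.2 with hn | hF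
  · exact Or.inl (hA ▸ hn.comap _)
  · refine Or.inr (hform.mem_quotient_normalCore hher
      ((QuotientGroup.mk' (A.subgroupOf B).normalCore).comp φ.symm.toMonoidHom) hF _ ?_)
    intro x hx
    have hx' : φ.symm x ∈ (A.subgroupOf B).normalCore := (QuotientGroup.eq_one_iff _).mp hx
    rw [hA]
    exact (Subgroup.normalCore_le (A.subgroupOf B) hx' :)

theorem IsKSubnormal.map (hform : F.IsFormation) (hher : F.IsHereditary) (e : G ≃* G)
    {U : Subgroup G} (h : IsKSubnormal F U) : IsKSubnormal F (U.map e.toMonoidHom) := by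
  have := Relation.ReflTransGen.lift (p := KStep F)
    (fun A : Subgroup G => A.map e.toMonoidHom) (fun _ _ hAB => KStep.map hform hher e hAB) _ _ h
  rwa [Function.onFun_apply, Subgroup.map_top_of_surjective _ e.surjective] at this

theorem IsFMaximal.map (hform : F.IsFormation) (e : G ≃* G) {U : Subgroup G}
    (h : IsFMaximal F U) : IsFMaximal F (U.map e.toMonoidHom) := by
  refine ⟨hform.mem_of_mulEquiv (e.subgroupMap U) h.1, fun V hV hUV => ?_⟩
  have h1 : V.map e.symm.toMonoidHom ≤ U := h.2 (hform.mem_of_mulEquiv (e.symm.subgroupMap V) hV)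
    fun u hu => ⟨e u, hUV ⟨u, hu, rfl⟩, e.symm_apply_apply u⟩
  exact fun v hv => ⟨e.symm v, h1 ⟨v, hv, rfl⟩, e.apply_symm_apply v⟩

/-- Conjugation permutes the `F`-maximal subgroups that are not `K`-`F`-subnormal. -/
theorem intMaximalStar_normal (hform : F.IsFormation) (hher : F.IsHereditary) :
    (intMaximalStar G F).Normal where
  conj_mem := by
    intro x hx g
    refine Subgroup.mem_sInf.mpr fun U ⟨hU, hK⟩ => ?_
    let e : G ≃* G := MulAut.conj g
    have hmem : x ∈ U.map e.symm.toMonoidHom := by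
      refine Subgroup.mem_sInf.mp hx _ ⟨hU.map hform e.symm, fun hK' => hK ?_⟩
      have := hK'.map hform hher e
      rw [Subgroup.map_map] at this
      simpa using this
    obtain ⟨y, hy, rfl⟩ := hmem
    have hgy : g * e.symm.toMonoidHom y * g⁻¹ = y := e.apply_symm_apply y
    rw [hgy]
    exact hy

/-- Membership in `F` lifts along `Int*_F(G)`: a subgroup `H` is in `F` as soon as
`H ⧸ (H ∩ Int*_F(G))` is. -/
theorem mem_of_quotient_intMaximalStar (hform : F.IsFormation) (hsat : F.IsSaturated)
    (hher : F.IsHereditary) (hnil : F.ContainsNilpotent) [hD : (intMaximalStar G F).Normal]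
    (H : Subgroup G) (hH : F (H ⧸ (intMaximalStar G F).subgroupOf H)) : F H := by
  induction H using WellFoundedLT.induction with
  | ind H ih =>
  by_contra hHF
  refine hHF (mem_of_forall_isCoatom hform hsat hher hnil fun M hM => ?_)
  by_cases hDM : (intMaximalStar G F).subgroupOf H ≤ M
  · refine hform.mem_quotient_normalCore hher (QuotientGroup.mk' _) hH M ?_
    rwa [QuotientGroup.ker_mk']
  · obtain ⟨L, hLH, rfl⟩ : ∃ L : Subgroup G, L < H ∧ L.subgroupOf H = M := by
      have hsub : (M.map H.subtype).subgroupOf H = M :=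
        Subgroup.comap_map_eq_self_of_injective H.subtype_injective M
      refine ⟨M.map H.subtype, lt_of_le_of_ne (Subgroup.map_subtype_le M) fun he => hM.1 ?_, hsub⟩
      rw [← hsub, he, Subgroup.subgroupOf_self]
    have hLF : F L := by
      refine ih L hLH (hform.mem_quotient_of_ker_le hher
        ((QuotientGroup.mk' ((intMaximalStar G F).subgroupOf H)).comp
          (Subgroup.inclusion hLH.le)) hH _ ?_)
      intro x hx
      exact (QuotientGroup.eq_one_iff (Subgroup.inclusion hLH.le x)).mp hx
    obtain ⟨W, hLW, hW⟩ := exists_isFMaximal_le F hLF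
    have hWH : W.subgroupOf H = L.subgroupOf H := by
      -- Otherwise `H ≤ W`, and `H` would be in `F` by heredity.
      rcases (Subgroup.comap_mono hLW : L.subgroupOf H ≤ W.subgroupOf H).eq_or_lt with he | hlt
      · exact he.symm
      · exact absurd (hher.mem_of_le hform (Subgroup.subgroupOf_eq_top.mp (hM.2 _ hlt)) hW.1) hHF
    have hWK : IsKSubnormal F W := by
      by_contra hWK
      refine hDM (hWH ▸ Subgroup.comap_mono ?_)
      exact sInf_le ⟨hW, hWK⟩
    exact mem_quotient_normalCore_of_isKSubnormal hform hher hnil hWK hWH hM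

end GroupClass

theorem theoremD (F : GroupClass.{u}) (hform : F.IsFormation) (hsat : F.IsSaturated)
    (hher : F.IsHereditary) (hnil : F.ContainsNilpotent)
    (G : Type u) [Group G] [Finite G] :
    GroupClass.intMaximalStar G F = GroupClass.intMaximal G F := by
  have hD : (GroupClass.intMaximalStar G F).Normal :=
    GroupClass.intMaximalStar_normal hform hher
  refine le_antisymm (le_sInf fun U hU => ?_) (sInf_le_sInf fun U hU => hU.1)
  have hsup : F (U ⊔ GroupClass.intMaximalStar G F : Subgroup G) := by
    refine GroupClass.mem_of_quotient_intMaximalStar hform hsat hher hnil _ ?_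
    exact hform.mem_of_mulEquiv (QuotientGroup.quotientInfEquivProdNormalQuotient U _)
      (hform.image U _ (QuotientGroup.mk' _) (QuotientGroup.mk'_surjective _) hU.1)
  exact le_sup_right.trans (hU.2 hsup le_sup_left)
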